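/- Let $G$ be a group. For $S\subseteq G$ let $\mathrm{Cay}(G,S)$ be the digraph with vertex set $G$ and an arc from $x$ to $xs$ for all $x\in G$, $s\in S$; if $S=S^{-1}$ it is regarded as an undirected graph. The digraph $\mathrm{Cay}(G,S)$ is a DCI-graph if for every $S'\subseteq G$ with $\mathrm{Cay}(G,S)\cong\mathrm{Cay}(G,S')$ there is a group automorphism $\alpha$ of $G$ with $\alpha(S)=S'$. If $S=S^{-1}$, the graph $\mathrm{Cay}(G,S)$ is a CI-graph if the same holds for every $S'\subseteq G$ with $S'=S'^{-1}$. For every integer $n>1$ there is a natural number $k_n$ such that the following holds. Let $S\subseteq\mathbb Z^n$ be a finite set containing at least one non-zero element, so that $\mathrm{Cay}(\mathbb Z^n,S)$ is locally finite and has an arc between distinct vertices, and suppose that the underlying undirected graph of $\mathrm{Cay}(\mathbb Z^n,S)$ has at least $k_n$ (possibly infinitely many) connected components. Then $\mathrm{Cay}(\mathbb Z^n,S)$ is not a DCI-graph; and if $S=-S$, then $\mathrm{Cay}(\mathbb Z^n,S)$ is not a CI-graph. -/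

import Mathlib

/-- The Cayley digraph `Cay(G, S)` of an additive group `G`: there is an arc from `x` to `y` exactly
when `y = x + s` for some `s ∈ S`. (There is a loop at every vertex if and only if `0 ∈ S`.) -/
def cayleyDigraph {G : Type*} [AddGroup G] (S : Set G) : Digraph G where
  Adj x y := ∃ s ∈ S, y = x + s

/-- `S` is closed under inverses. Exactly in this case the arcs of `Cay(G, S)` come in opposite
pairs, so that `Cay(G, S)` is an undirected graph. -/
def IsInverseClosed {G : Type*} [AddGroup G] (S : Set G) : Prop :=
  ∀ s ∈ S, -s ∈ S

/-- `Cay(G, S)` is a DCI-graph: whenever it is isomorphic to a Cayley digraph `Cay(G, S')`,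
some automorphism of the group `G` maps `S` onto `S'`. -/
def IsDCIGraph {G : Type*} [AddGroup G] (S : Set G) : Prop :=
  ∀ S' : Set G, Nonempty ((cayleyDigraph S).Adj ≃r (cayleyDigraph S').Adj) →
    ∃ α : G ≃+ G, α '' S = S'

/-- The undirected Cayley graph `Cay(G, S)` (`S` closed under inverses) is a CI-graph: whenever it
is isomorphic to an undirected Cayley graph `Cay(G, S')`, some automorphism of the group `G`
maps `S` onto `S'`. -/
def IsCIGraph {G : Type*} [AddGroup G] (S : Set G) : Prop :=
  IsInverseClosed S ∧
    ∀ S' : Set G, IsInverseClosed S' →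
      Nonempty ((cayleyDigraph S).Adj ≃r (cayleyDigraph S').Adj) →
        ∃ α : G ≃+ G, α '' S = S'

/-- The number (possibly `⊤`) of connected components of the underlying undirected graph of
`Cay(G, S)`. -/
noncomputable def numComponents {G : Type*} [AddGroup G] (S : Set G) : ℕ∞ :=
  ENat.card (cayleyDigraph S).toSimpleGraphInclusive.ConnectedComponent

/-! Let `L` be the subgroup generated by `S`. The digraph is a disjoint union of copies of Cay(L,
S), one per coset of `L`, so another embedding of `L` with equinumerous cosets gives an isomorphic
digraph. If `L` has infinite index, doubling is such an embedding, and no automorphism takes `S` to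
`2S`, since elements of `S` would be divisible by every power of 2. If `L` has finite index `m`, it
is a copy of `ℤ ^ n` in which `S` corresponds to a finite generating set `T`. The `m` maps
`shearScale i j m c`, `0 ≤ c < m`, embed `ℤ ^ n` with index `m`. If automorphisms took `S` to all
`m` images of `T`, they would induce `m` distinct automorphisms of `ℤ ^ n` preserving `T`. Quotients
of these have finite order, so by Minkowski's lemma they stay distinct modulo 3, whence `m ≤ 3 ^ (n
^ 2)`. -/

/-! ### Components and cosets -/

/-- The number of components of `Cay(G, S)` is at most the index of the subgroup generated
by `S`. -/
theorem numComponents_le_card_quotient {G : Type*} [AddCommGroup G] (S : Set G) :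
    numComponents S ≤ ENat.card (G ⧸ AddSubgroup.closure S) := by
  have reach : ∀ d ∈ AddSubgroup.closure S, ∀ x : G,
      (cayleyDigraph S).toSimpleGraphInclusive.Reachable x (x + d) := by
    intro d hd
    induction hd using AddSubgroup.closure_induction with
    | mem s hs =>
      intro x
      -- A zero generator gives a loop, which the simple graph discards.
      by_cases h : x = x + s
      · rw [← h]
      · exact SimpleGraph.Adj.reachable ⟨h, Or.inl ⟨s, hs, rfl⟩⟩
    | zero => intro x; simp
    | add a b _ _ ha hb =>
      intro x
      rw [← add_assoc]
      exact (ha x).trans (hb (x + a))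
    | neg a _ ha =>
      intro x
      simpa using (ha (x + -a)).symm
  let f : G ⧸ AddSubgroup.closure S →
      (cayleyDigraph S).toSimpleGraphInclusive.ConnectedComponent :=
    Quotient.lift (fun x ↦ SimpleGraph.connectedComponentMk _ x) (by
      intro a b hab
      have hab' : -a + b ∈ AddSubgroup.closure S := QuotientAddGroup.leftRel_apply.1 hab
      refine SimpleGraph.ConnectedComponent.sound ?_
      simpa using reach _ hab' a)
  have hf : Function.Surjective f := by
    intro c
    induction c using SimpleGraph.ConnectedComponent.ind with
    | h v => exact ⟨QuotientAddGroup.mk v, rfl⟩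
  exact ENat.card_le_card_of_injective (Function.injective_surjInv hf)

/-- Coordinates on `G` consisting of a coset of the range of an injective homomorphism and an
element of its source. -/
theorem exists_equiv_quotient_range_prod {G H : Type*} [AddCommGroup G] [AddCommGroup H]
    (i : H →+ G) (hi : Function.Injective i) :
    ∃ E : (G ⧸ i.range) × H ≃ G, ∀ q h, E (q, h) = q.out + i h := by
  refine ⟨Equiv.ofBijective (fun p ↦ p.1.out + i p.2) ⟨?_, ?_⟩, fun _ _ ↦ rfl⟩
  · rintro ⟨q, h⟩ ⟨q', h'⟩ e
    have e' : q.out + i h = q'.out + i h' := e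
    have hq : q = q' := by
      rw [← Quotient.out_eq' q, ← Quotient.out_eq' q']
      refine QuotientAddGroup.eq.2 ⟨h - h', ?_⟩
      rw [map_sub, sub_eq_iff_eq_add, add_assoc, ← e']
      abel
    subst hq
    exact Prod.ext rfl (hi (add_left_cancel e'))
  · intro g
    have hg : -(QuotientAddGroup.mk g : G ⧸ i.range).out + g ∈ i.range :=
      QuotientAddGroup.eq.1 (Quotient.out_eq' _)
    obtain ⟨h, hh⟩ := hg
    exact ⟨(QuotientAddGroup.mk g, h), by simp [hh]⟩

/-- Adding `i t` keeps the coset representative and shifts only the second coordinate. -/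
theorem cayleyDigraph_image_adj_iff {G H : Type*} [AddCommGroup G] [AddCommGroup H]
    (i : H →+ G) (T : Set H) (E : (G ⧸ i.range) × H ≃ G)
    (hE : ∀ q h, E (q, h) = q.out + i h) (p p' : (G ⧸ i.range) × H) :
    (cayleyDigraph (i '' T)).Adj (E p) (E p') ↔ p.1 = p'.1 ∧ ∃ t ∈ T, p'.2 = p.2 + t := by
  have key : ∀ t, E p + i t = E (p.1, p.2 + t) := by
    intro t
    rw [← Prod.mk.eta (p := p), hE, hE, map_add, add_assoc]
  constructor
  · rintro ⟨_, ⟨t, ht, rfl⟩, h⟩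
    rw [key] at h
    have h' := E.injective h
    exact ⟨by rw [h'], t, ht, by rw [h']⟩
  · rintro ⟨h1, t, ht, h2⟩
    exact ⟨i t, ⟨t, ht, rfl⟩, by rw [key, h1, ← h2]⟩

/-- The Cayley digraphs of two embedded copies of a connection set are isomorphic as soon as the
two subgroups have equinumerous sets of cosets. -/
theorem nonempty_cayleyDigraph_image_relIso {G H : Type*} [AddCommGroup G] [AddCommGroup H]
    (i j : H →+ G) (hi : Function.Injective i) (hj : Function.Injective j)
    (e : (G ⧸ i.range) ≃ (G ⧸ j.range)) (T : Set H) :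
    Nonempty ((cayleyDigraph (i '' T)).Adj ≃r (cayleyDigraph (j '' T)).Adj) := by
  obtain ⟨E, hE⟩ := exists_equiv_quotient_range_prod i hi
  obtain ⟨F, hF⟩ := exists_equiv_quotient_range_prod j hj
  refine ⟨⟨(E.symm.trans (e.prodCongr (Equiv.refl H))).trans F, ?_⟩⟩
  intro a b
  obtain ⟨p, rfl⟩ := E.surjective a
  obtain ⟨p', rfl⟩ := E.surjective b
  simp [cayleyDigraph_image_adj_iff i T E hE, cayleyDigraph_image_adj_iff j T F hF]

/-! ### Minkowski's lemma modulo 3 -/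

/-- An integer matrix of finite order that is congruent to the identity modulo `3` is the
identity. -/
theorem Matrix.eq_one_of_pow_eq_one_of_map_eq_one {ι : Type*} [Fintype ι] [DecidableEq ι]
    (N : ℕ) (hN : 0 < N) (A : Matrix ι ι ℤ)
    (hA : (Int.castRingHom (ZMod 3)).mapMatrix A = 1) (hpow : A ^ N = 1) : A = 1 := by
  have : Fact (Nat.Prime 3) := ⟨Nat.prime_three⟩
  have cancel : ∀ B C : Matrix ι ι ℤ, (Int.castRingHom (ZMod 3) B.det) ≠ 0 → B * C = 0 →
      C = 0 := by
    intro B C hB h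
    have hdet : B.det ≠ 0 := fun h0 ↦ hB (by rw [h0, map_zero])
    have h2 : B.adjugate * (B * C) = 0 := by rw [h, mul_zero]
    rw [← mul_assoc, Matrix.adjugate_mul, Matrix.smul_mul, one_mul] at h2
    exact (smul_eq_zero.1 h2).resolve_left hdet
  have cube : ∀ A : Matrix ι ι ℤ, (Int.castRingHom (ZMod 3)).mapMatrix A = 1 → A ^ 3 = 1 →
      A = 1 := by
    intro A hA h3
    have hdiv : ∀ i j, ∃ b : ℤ, (A - 1) i j = 3 * b := by
      intro i j
      refine (ZMod.intCast_zmod_eq_zero_iff_dvd _ 3).1 ?_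
      have h0 : (Int.castRingHom (ZMod 3)).mapMatrix (A - 1) = 0 := by
        rw [map_sub, hA, map_one, sub_self]
      exact congrFun (congrFun h0 i) j
    choose b hb using hdiv
    let B : Matrix ι ι ℤ := Matrix.of b
    have hAB : A = 1 + 3 * B := by
      have : A - 1 = (3 : ℤ) • B := by ext i j; simpa [B] using hb i j
      rw [eq_add_of_sub_eq' this, zsmul_eq_mul]; norm_num
    have hB : B = 0 := by
      -- From `A ^ 3 - 1 = 9 (1 + 3 (B + B ^ 2)) B`; the middle factor is the identity modulo 3.
      refine cancel (1 + 3 * (B + B ^ 2)) B ?_ ?_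
      · rw [RingHom.map_det, map_add, map_mul, map_one]
        have : (Int.castRingHom (ZMod 3)).mapMatrix (3 : Matrix ι ι ℤ) = 0 := by
          have h30 : (3 : Matrix ι ι (ZMod 3)) = 0 := by
            have := congrArg (algebraMap (ZMod 3) (Matrix ι ι (ZMod 3)))
              (show (3 : ZMod 3) = 0 from rfl)
            rwa [map_ofNat, map_zero] at this
          rw [map_ofNat, h30]
        rw [this, zero_mul, add_zero, Matrix.det_one]
        exact one_ne_zero
      · have h9 : (9 : ℤ) • ((1 + 3 * (B + B ^ 2)) * B) = 0 := by
          have : (9 : ℤ) • ((1 + 3 * (B + B ^ 2)) * B) = A ^ 3 - 1 := by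
            rw [hAB]; noncomm_ring
          rw [this, h3, sub_self]
        exact (smul_eq_zero.1 h9).resolve_left (by norm_num)
    rw [hAB, hB, mul_zero, add_zero]
  induction N using Nat.strong_induction_on with
  | _ N ih =>
    by_cases hd : 3 ∣ N
    · obtain ⟨k, rfl⟩ := hd
      refine ih k (by omega) (by omega) (cube _ ?_ ?_)
      · rw [map_pow, hA, one_pow]
      · rw [← pow_mul, mul_comm, hpow]
    -- The geometric sum is `N` times the identity modulo 3, with determinant a power of `N`,
    -- nonzero as 3 does not divide `N`.
    · refine sub_eq_zero.1 (cancel (∑ i ∈ Finset.range N, A ^ i) _ ?_ ?_)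
      · rw [RingHom.map_det, map_sum]
        simp only [map_pow, hA, one_pow, Finset.sum_const, Finset.card_range]
        rw [Matrix.det_smul_of_tower, Matrix.det_one]
        rw [nsmul_eq_mul, mul_one, Nat.cast_pow]
        exact pow_ne_zero _ fun h ↦ hd ((ZMod.natCast_eq_zero_iff N 3).1 h)
      · rw [geom_sum_mul, hpow, sub_self]

/-- A linear automorphism that permutes a finite generating set has finite order. -/
theorem LinearEquiv.exists_pow_eq_one_of_image_eq {M : Type*} [AddCommGroup M] (T : Set M)
    (hT : T.Finite) (hspan : Submodule.span ℤ T = ⊤) (g : M ≃ₗ[ℤ] M) (hg : g '' T = T) :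
    ∃ N : ℕ, 0 < N ∧ g ^ N = 1 := by
  have : Finite T := hT
  have hmem : ∀ k : ℕ, ∀ t ∈ T, (g ^ k) t ∈ T := by
    intro k
    induction k with
    | zero => intro t ht; simpa using ht
    | succ k ih =>
      intro t ht
      rw [pow_succ']
      exact hg ▸ ⟨_, ih t ht, rfl⟩
  obtain ⟨k, l, hne, h⟩ := Finite.exists_ne_map_eq_of_infinite
    (fun (k : ℕ) (t : T) ↦ (⟨(g ^ k) t, hmem k t t.2⟩ : T))
  wlog hkl : k < l generalizing k l
  · exact this l k hne.symm h.symm (by omega)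
  refine ⟨l - k, by omega, ?_⟩
  have heq : g ^ k = g ^ l := by
    apply LinearEquiv.toLinearMap_injective
    refine LinearMap.ext_on hspan fun t ht ↦ ?_
    exact congrArg Subtype.val (congrFun h ⟨t, ht⟩)
  rw [pow_sub g hkl.le, heq, mul_inv_cancel]

/-! ### Sheared embeddings of index `m` -/

/-- The endomorphism of `ℤ ^ ι` multiplying coordinate `i` by `m` and adding `c` times the old
coordinate `i` to coordinate `j`. -/
def shearScale {ι : Type*} [DecidableEq ι] (i j : ι) (m c : ℤ) : (ι → ℤ) →ₗ[ℤ] (ι → ℤ) where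
  toFun x k := if k = i then m * x i else if k = j then x j + c * x i else x k
  map_add' x y := by
    ext k
    simp only [Pi.add_apply]
    split_ifs <;> ring
  map_smul' a x := by
    ext k
    simp only [Pi.smul_apply, smul_eq_mul, RingHom.id_apply]
    split_ifs <;> ring

theorem shearScale_apply {ι : Type*} [DecidableEq ι] (i j : ι) (m c : ℤ) (x : ι → ℤ) (k : ι) :
    shearScale i j m c x k =
      if k = i then m * x i else if k = j then x j + c * x i else x k := rfl

theorem shearScale_injective {ι : Type*} [DecidableEq ι] (i j : ι) {m : ℤ} (hm : m ≠ 0) (c : ℤ) :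
    Function.Injective (shearScale i j m c) := by
  rw [← LinearMap.ker_eq_bot, LinearMap.ker_eq_bot']
  intro x hx
  have h k : shearScale i j m c x k = 0 := congrFun hx k
  have hi : x i = 0 := by
    have := h i
    rw [shearScale_apply, if_pos rfl] at this
    exact (mul_eq_zero.1 this).resolve_left hm
  ext k
  have hk := h k
  rw [shearScale_apply, hi] at hk
  split_ifs at hk with h1 h2
  · rw [h1, hi, Pi.zero_apply]
  · simpa [h2] using hk
  · exact hk

/-- For every `c` the range is the same: the vectors whose coordinate `i` is divisible by `m`. -/
theorem card_quotient_range_shearScale {ι : Type*} [DecidableEq ι] {i j : ι} (hij : i ≠ j)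
    (m : ℕ) (c : ℤ) :
    Nat.card ((ι → ℤ) ⧸ (shearScale i j m c).toAddMonoidHom.range) = m := by
  let f : (ι → ℤ) →+ ZMod m := (Int.castAddHom (ZMod m)).comp (Pi.evalAddMonoidHom _ i)
  have hf : Function.Surjective f := by
    intro z
    obtain ⟨a, rfl⟩ := ZMod.intCast_surjective z
    exact ⟨fun _ ↦ a, rfl⟩
  have hker : (shearScale i j m c).toAddMonoidHom.range = f.ker := by
    ext y
    rw [AddMonoidHom.mem_ker]
    constructor
    · rintro ⟨x, rfl⟩
      change ((shearScale i j m c x i : ℤ) : ZMod m) = 0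
      simp [shearScale_apply]
    · intro hy
      obtain ⟨b, hb⟩ := (ZMod.intCast_zmod_eq_zero_iff_dvd (y i) m).1 hy
      let x : ι → ℤ := fun k ↦ if k = i then b else if k = j then y j - c * b else y k
      have hxi : x i = b := if_pos rfl
      have hxj : x j = y j - c * b := by simp [x, hij.symm]
      refine ⟨x, funext fun k ↦ ?_⟩
      change shearScale i j m c x k = y k
      rw [shearScale_apply]
      by_cases h1 : k = i
      · simp [h1, hxi, hb]
      · by_cases h2 : k = j
        · simp [h2, hij.symm, hxi, hxj]
        · simp [h1, h2, x]
  rw [hker]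
  change f.ker.index = m
  rw [AddSubgroup.index_ker, AddMonoidHom.range_eq_top.2 hf, AddSubgroup.card_top,
    Nat.card_zmod]

/-- If two of the maps `shearScale i j m c` differ by an automorphism of the target, their
parameters agree modulo `m`. -/
theorem dvd_sub_of_comp_shearScale_eq {ι : Type*} [DecidableEq ι] {i j : ι} (hij : i ≠ j)
    (m c c' : ℤ) (α : (ι → ℤ) →ₗ[ℤ] (ι → ℤ))
    (h : ∀ x, α (shearScale i j m c x) = shearScale i j m c' x) : m ∣ c' - c := by
  have e1 c : shearScale i j m c (Pi.single j 1) = Pi.single j 1 := by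
    ext k
    rw [shearScale_apply]
    by_cases h1 : k = i
    · subst h1; simp [hij]
    · by_cases h2 : k = j
      · subst h2; simp [hij.symm]
      · simp [h1, h2]
  have e0 c : shearScale i j m c (Pi.single i 1) = m • Pi.single i 1 + c • Pi.single j 1 := by
    ext k
    rw [shearScale_apply]
    by_cases h1 : k = i
    · subst h1; simp [hij]
    · by_cases h2 : k = j
      · subst h2; simp [hij.symm]
      · simp [h1, h2]
  have h1 := h (Pi.single j 1)
  have h0 := h (Pi.single i 1)
  rw [e1, e1] at h1
  rw [e0, e0, map_add, map_smul, map_smul, h1] at h0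
  have h2 := congrFun h0 j
  simp [hij.symm] at h2
  exact ⟨α (Pi.single i 1) j, by linarith⟩

/-! ### Counting the twists -/

/-- Automorphisms of `ℤ ^ ι` permuting a finite generating set are determined by their matrices
modulo `3`. -/
theorem LinearEquiv.eq_of_toMatrix_mod_three_eq {ι : Type*} [Fintype ι] [DecidableEq ι]
    (T : Set (ι → ℤ)) (hT : T.Finite) (hspan : Submodule.span ℤ T = ⊤)
    (g g' : (ι → ℤ) ≃ₗ[ℤ] (ι → ℤ)) (hg : g '' T = T) (hg' : g' '' T = T)
    (h : (Int.castRingHom (ZMod 3)).mapMatrix (LinearMap.toMatrixAlgEquiv' g.toLinearMap) =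
      (Int.castRingHom (ZMod 3)).mapMatrix (LinearMap.toMatrixAlgEquiv' g'.toLinearMap)) :
    g = g' := by
  let Φ : ((ι → ℤ) ≃ₗ[ℤ] (ι → ℤ)) →* Matrix ι ι ℤ :=
    (LinearMap.toMatrixAlgEquiv' : ((ι → ℤ) →ₗ[ℤ] (ι → ℤ)) ≃ₐ[ℤ] _).toMonoidHom.comp
      LinearEquiv.automorphismGroup.toLinearMapMonoidHom
  let Ψ : ((ι → ℤ) ≃ₗ[ℤ] (ι → ℤ)) →* Matrix ι ι (ZMod 3) :=
    (Int.castRingHom (ZMod 3)).mapMatrix.toMonoidHom.comp Φ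
  have hΨ : Ψ g = Ψ g' := h
  have hinv : (g⁻¹ * g') '' T = T := by
    have : (g⁻¹ * g') '' T = g.symm '' (g' '' T) := by
      rw [Set.image_image]; rfl
    rw [this, hg']
    conv_lhs => rw [← hg]
    rw [Set.image_image]
    simp
  obtain ⟨N, hN, hpow⟩ := LinearEquiv.exists_pow_eq_one_of_image_eq T hT hspan _ hinv
  have h1 : Φ (g⁻¹ * g') = 1 := by
    refine Matrix.eq_one_of_pow_eq_one_of_map_eq_one N hN _ ?_ ?_
    · change Ψ (g⁻¹ * g') = 1
      rw [map_mul, ← hΨ, ← map_mul, inv_mul_cancel, map_one]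
    · rw [← map_pow, hpow, map_one]
  have h2 : g⁻¹ * g' = 1 := by
    apply LinearEquiv.toLinearMap_injective
    apply (LinearMap.toMatrixAlgEquiv' : ((ι → ℤ) →ₗ[ℤ] (ι → ℤ)) ≃ₐ[ℤ] _).injective
    exact h1.trans (map_one Φ).symm
  exact inv_mul_eq_one.1 h2

/-- If every twist of an embedding of `ℤ ^ ι` by the maps `shearScale i j m c` is realised on a
finite generating set by an automorphism of the target, then `m` is at most the number of matrices
modulo `3`. -/
theorem le_card_matrix_of_forall_exists_image_eq {ι : Type*} [Fintype ι] [DecidableEq ι]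
    {i j : ι} (hij : i ≠ j) {m : ℕ} (hm : 0 < m) (T : Set (ι → ℤ)) (hT : T.Finite)
    (hspan : Submodule.span ℤ T = ⊤) (f : (ι → ℤ) →ₗ[ℤ] (ι → ℤ)) (hf : Function.Injective f)
    (h : ∀ c : Fin m, ∃ α : (ι → ℤ) ≃ₗ[ℤ] (ι → ℤ), α '' (f '' T) = shearScale i j m c '' T) :
    m ≤ 3 ^ (Fintype.card ι ^ 2) := by
  have hinj c : Function.Injective (shearScale i j m c) :=
    shearScale_injective i j (by exact_mod_cast hm.ne') c
  choose α hα using h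
  have hrange : ∀ c : Fin m, LinearMap.range ((α c).toLinearMap.comp f) =
      LinearMap.range (shearScale i j m c) := by
    intro c
    rw [LinearMap.range_eq_map, LinearMap.range_eq_map, ← hspan, Submodule.map_span,
      Submodule.map_span, ← hα c, Set.image_image]
    rfl
  have hαf c : Function.Injective ((α c).toLinearMap.comp f) := (α c).injective.comp hf
  -- `α c ∘ f` and the shear have equal range, so they differ by an automorphism `g c` of the
  -- source.
  let g : Fin m → ((ι → ℤ) ≃ₗ[ℤ] (ι → ℤ)) := fun c ↦
    ((LinearEquiv.ofInjective _ (hαf c)).trans (LinearEquiv.ofEq _ _ (hrange c))).trans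
      (LinearEquiv.ofInjective _ (hinj c)).symm
  have hg : ∀ (c : Fin m) x, shearScale i j m c (g c x) = α c (f x) := by
    intro c x
    have := (LinearEquiv.ofInjective _ (hinj c)).apply_symm_apply
      (((LinearEquiv.ofInjective _ (hαf c)).trans (LinearEquiv.ofEq _ _ (hrange c))) x)
    exact congrArg Subtype.val this
  have hgT : ∀ c, g c '' T = T := by
    intro c
    refine (hinj c).image_injective ?_
    rw [← hα c, Set.image_image, Set.image_image]
    simp only [hg]
  have hcard : Fintype.card (Matrix ι ι (ZMod 3)) = 3 ^ (Fintype.card ι ^ 2) := by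
    rw [← Nat.card_eq_fintype_card]
    change Nat.card (ι → ι → ZMod 3) = _
    simp [← pow_mul, sq]
  rw [← hcard, ← Fintype.card_fin m]
  refine Fintype.card_le_of_injective (fun c ↦ (Int.castRingHom (ZMod 3)).mapMatrix
    (LinearMap.toMatrixAlgEquiv' (g c).toLinearMap)) ?_
  intro c c' hcc
  have hgg := LinearEquiv.eq_of_toMatrix_mod_three_eq T hT hspan _ _ (hgT c) (hgT c') hcc
  -- When `g c = g c'`, the map `α c' ∘ (α c)⁻¹` carries one shear to the other.
  have hdvd : (m : ℤ) ∣ (c' : ℤ) - c := by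
    refine dvd_sub_of_comp_shearScale_eq hij m c c'
      ((α c').toLinearMap.comp (α c).symm.toLinearMap) fun x ↦ ?_
    obtain ⟨y, rfl⟩ := (g c).surjective x
    rw [hg, hgg, hg]
    simp
  have hlt : |(c' : ℤ) - c| < m := by
    rw [abs_lt]; omega
  have := Int.eq_zero_of_abs_lt_dvd hdvd hlt
  exact Fin.ext (by omega)

/-! ### Infinite and finite index -/

theorem IsInverseClosed.image {G H : Type*} [AddGroup G] [AddGroup H] {S : Set G}
    (hS : IsInverseClosed S) (f : G →+ H) : IsInverseClosed (f '' S) := by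
  rintro _ ⟨s, hs, rfl⟩
  exact ⟨-s, hS s hs, map_neg f s⟩

theorem IsInverseClosed.preimage {G H : Type*} [AddGroup G] [AddGroup H] {S : Set H}
    (hS : IsInverseClosed S) (f : G →+ H) : IsInverseClosed (f ⁻¹' S) := by
  intro s hs
  rw [Set.mem_preimage, map_neg]
  exact hS _ hs

/-- No automorphism of `ℤ ^ ι` maps a set with a nonzero element onto its double. -/
theorem image_ne_image_two_smul {ι : Type*} (S : Set (ι → ℤ)) (hS : ∃ s ∈ S, s ≠ 0)
    (α : (ι → ℤ) ≃+ (ι → ℤ)) : α '' S ≠ (fun x ↦ (2 : ℤ) • x) '' S := by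
  intro h
  have hdiv : ∀ k : ℕ, ∀ s ∈ S, ∃ t : ι → ℤ, s = (2 : ℤ) ^ k • t := by
    intro k
    induction k with
    | zero => exact fun s _ ↦ ⟨s, by simp⟩
    | succ k ih =>
      intro s hs
      have hmem : α s ∈ (fun x ↦ (2 : ℤ) • x) '' S := h ▸ ⟨s, hs, rfl⟩
      obtain ⟨s', hs', e⟩ := hmem
      obtain ⟨t, rfl⟩ := ih s' hs'
      refine ⟨α.symm t, α.injective ?_⟩
      rw [map_zsmul, α.apply_symm_apply, ← e, pow_succ', mul_smul]
  obtain ⟨s, hs, hs0⟩ := hS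
  obtain ⟨i, hi⟩ := Function.ne_iff.1 hs0
  -- This exponent suffices because `a < 2 ^ a`.
  obtain ⟨t, ht⟩ := hdiv (s i).natAbs s hs
  have hd : (2 : ℤ) ^ (s i).natAbs ∣ s i := ⟨t i, congrFun ht i⟩
  have hle := Nat.le_of_dvd (Int.natAbs_pos.2 hi) (Int.natAbs_dvd_natAbs.2 hd)
  rw [Int.natAbs_pow] at hle
  exact absurd hle (not_le.2 Nat.lt_two_pow_self)

theorem exists_cayleyDigraph_relIso_of_infinite_quotient {ι : Type*} [Finite ι]
    (S : Set (ι → ℤ)) (hS : ∃ s ∈ S, s ≠ 0)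
    (hinf : Infinite ((ι → ℤ) ⧸ AddSubgroup.closure S)) :
    ∃ S' : Set (ι → ℤ), (IsInverseClosed S → IsInverseClosed S') ∧
      Nonempty ((cayleyDigraph S).Adj ≃r (cayleyDigraph S').Adj) ∧
      ∀ α : (ι → ℤ) ≃+ (ι → ℤ), α '' S ≠ S' := by
  let d : (ι → ℤ) →+ (ι → ℤ) := DistribSMul.toAddMonoidHom _ (2 : ℤ)
  let i := (AddSubgroup.closure S).subtype
  have hd : Function.Injective d := fun x y h ↦ smul_right_injective _ (two_ne_zero' ℤ) h
  have hi : Function.Injective i := Subtype.val_injective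
  have hir : i.range = AddSubgroup.closure S := AddSubgroup.range_subtype _
  have hle : (d.comp i).range ≤ AddSubgroup.closure S := by
    rintro _ ⟨x, rfl⟩
    exact AddSubgroup.zsmul_mem _ x.2 2
  have hinf1 : Infinite ((ι → ℤ) ⧸ i.range) := by rwa [hir]
  have hinf2 : Infinite ((ι → ℤ) ⧸ (d.comp i).range) := by
    refine Infinite.of_surjective (QuotientAddGroup.map _ (AddSubgroup.closure S)
      (AddMonoidHom.id _) hle) ?_
    intro q
    obtain ⟨x, rfl⟩ := QuotientAddGroup.mk_surjective q
    exact ⟨QuotientAddGroup.mk x, rfl⟩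
  have hc (K : AddSubgroup (ι → ℤ)) : Countable ((ι → ℤ) ⧸ K) :=
    (QuotientAddGroup.mk_surjective (s := K)).countable
  -- Both quotients are countably infinite.
  obtain ⟨e⟩ := nonempty_equiv_of_countable (α := (ι → ℤ) ⧸ i.range)
    (β := (ι → ℤ) ⧸ (d.comp i).range)
  have hS1 : i '' (i ⁻¹' S) = S := by
    rw [Set.image_preimage_eq_iff]
    exact fun s hs ↦ ⟨⟨s, AddSubgroup.subset_closure hs⟩, rfl⟩
  have hS2 : (d.comp i) '' (i ⁻¹' S) = d '' S := by
    conv_rhs => rw [← hS1, Set.image_image]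
    rfl
  have hiso := nonempty_cayleyDigraph_image_relIso i (d.comp i) hi (hd.comp hi) e (i ⁻¹' S)
  rw [hS1, hS2] at hiso
  exact ⟨d '' S, fun h ↦ h.image d, hiso, image_ne_image_two_smul S hS⟩

theorem exists_cayleyDigraph_relIso_of_finite_quotient {ι : Type*} [Fintype ι] [DecidableEq ι]
    {i j : ι} (hij : i ≠ j) (S : Set (ι → ℤ)) (hfin : S.Finite)
    (hquot : Finite ((ι → ℤ) ⧸ AddSubgroup.closure S))
    (hcard : 3 ^ (Fintype.card ι ^ 2) < Nat.card ((ι → ℤ) ⧸ AddSubgroup.closure S)) :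
    ∃ S' : Set (ι → ℤ), (IsInverseClosed S → IsInverseClosed S') ∧
      Nonempty ((cayleyDigraph S).Adj ≃r (cayleyDigraph S').Adj) ∧
      ∀ α : (ι → ℤ) ≃+ (ι → ℤ), α '' S ≠ S' := by
  set m := Nat.card ((ι → ℤ) ⧸ AddSubgroup.closure S) with hmdef
  have hm : 0 < m := (Nat.zero_le _).trans_lt hcard
  let L := Submodule.span ℤ S
  have hL : L.toAddSubgroup = AddSubgroup.closure S := Submodule.span_int_eq_addSubgroupClosure S
  have hquotL : Finite ((ι → ℤ) ⧸ L) := by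
    change Finite ((ι → ℤ) ⧸ L.toAddSubgroup)
    rwa [hL]
  -- Finite index forces full rank, so `L` is again a copy of `ℤ ^ ι`.
  have hrank : Module.finrank ℤ (ι → ℤ) = Module.finrank ℤ L :=
    (Submodule.finiteQuotient_iff L).1 hquotL |>.symm
  let b : (ι → ℤ) ≃ₗ[ℤ] L := LinearEquiv.ofFinrankEq _ _ hrank
  let f : (ι → ℤ) →ₗ[ℤ] (ι → ℤ) := L.subtype.comp b.toLinearMap
  have hf : Function.Injective f := Subtype.val_injective.comp b.injective
  have hfr : LinearMap.range f = L := by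
    rw [LinearMap.range_comp, LinearEquiv.range, Submodule.map_top, Submodule.range_subtype]
  have hfr' : f.toAddMonoidHom.range = AddSubgroup.closure S := by
    rw [← hL, ← hfr]; rfl
  let T := f ⁻¹' S
  have hfT : f '' T = S := by
    rw [Set.image_preimage_eq_iff]
    intro s hs
    have : s ∈ LinearMap.range f := hfr ▸ Submodule.subset_span hs
    exact this
  have hT : T.Finite := hfin.preimage hf.injOn
  have hspan : Submodule.span ℤ T = ⊤ := by
    apply Submodule.map_injective_of_injective hf
    rw [Submodule.map_span, hfT, Submodule.map_top, hfr]
  have hnot : ∃ c : Fin m, ∀ α : (ι → ℤ) ≃+ (ι → ℤ), α '' S ≠ shearScale i j m c '' T := by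
    by_contra! hall
    refine absurd (le_card_matrix_of_forall_exists_image_eq hij hm T hT hspan f hf fun c ↦ ?_)
      (not_le.2 hcard)
    obtain ⟨α, hα⟩ := hall c
    exact ⟨α.toIntLinearEquiv, by rw [hfT]; exact hα⟩
  obtain ⟨c, hc⟩ := hnot
  have hc1 : Nat.card ((ι → ℤ) ⧸ f.toAddMonoidHom.range) = m := by rw [hfr']
  have hc2 := card_quotient_range_shearScale hij m (c : ℤ)
  have : Finite ((ι → ℤ) ⧸ f.toAddMonoidHom.range) := Nat.finite_of_card_ne_zero (by omega)
  have : Finite ((ι → ℤ) ⧸ (shearScale i j m c).toAddMonoidHom.range) :=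
    Nat.finite_of_card_ne_zero (by omega)
  obtain ⟨e⟩ := Finite.card_eq.1 (hc1.trans hc2.symm)
  have hiso := nonempty_cayleyDigraph_image_relIso f.toAddMonoidHom
    (shearScale i j m c).toAddMonoidHom hf
    (shearScale_injective i j (by exact_mod_cast hm.ne') c) e T
  refine ⟨shearScale i j m c '' T, fun h ↦ ?_, ?_, hc⟩
  · exact (h.preimage f.toAddMonoidHom).image (shearScale i j m c).toAddMonoidHom
  · have hfT' : f.toAddMonoidHom '' T = S := hfT
    rw [hfT'] at hiso
    exact hiso

theorem mainTheorem7 (n : ℕ) (hn : 1 < n) :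
    ∃ k : ℕ, ∀ S : Set (Fin n → ℤ), S.Finite → (∃ s ∈ S, s ≠ 0) →
      (k : ℕ∞) ≤ numComponents S →
        ¬ IsDCIGraph S ∧ (IsInverseClosed S → ¬ IsCIGraph S) := by
  refine ⟨3 ^ (n ^ 2) + 1, fun S hfin hS hk ↦ ?_⟩
  have hk' := hk.trans (numComponents_le_card_quotient S)
  have hij : (⟨0, by omega⟩ : Fin n) ≠ ⟨1, hn⟩ := by simp
  obtain ⟨S', hinv, hiso, hne⟩ : ∃ S' : Set (Fin n → ℤ),
      (IsInverseClosed S → IsInverseClosed S') ∧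
      Nonempty ((cayleyDigraph S).Adj ≃r (cayleyDigraph S').Adj) ∧
      ∀ α : (Fin n → ℤ) ≃+ (Fin n → ℤ), α '' S ≠ S' := by
    rcases finite_or_infinite ((Fin n → ℤ) ⧸ AddSubgroup.closure S) with hq | hq
    · refine exists_cayleyDigraph_relIso_of_finite_quotient hij S hfin hq ?_
      rw [ENat.card_eq_coe_natCard, Nat.cast_le] at hk'
      rw [Fintype.card_fin]
      omega
    · exact exists_cayleyDigraph_relIso_of_infinite_quotient S hS hq
  refine ⟨fun h ↦ ?_, fun hSinv h ↦ ?_⟩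
  · obtain ⟨α, hα⟩ := h S' hiso
    exact hne α hα
  · obtain ⟨α, hα⟩ := h.2 S' (hinv hSinv) hiso
    exact hne α hα
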